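/- For $\tau\in\mathbb{C}$ with $\operatorname{Im}\tau>0$ write $q^{a}:=e^{2\pi i a\tau}$ ($a\in\mathbb{R}$), $J_1:=\prod_{n\ge1}(1-q^n)$, and let $\eta(\tau):=q^{1/24}\prod_{n\ge 1}(1-q^n)$ be Dedekind's eta function. For integers $N\ge 1$, $0\le \ell\le N$ and $m\equiv \ell \pmod 2$, the level-$N$ string function of the affine Lie algebra $A_1^{(1)}$ is $$c^{N-\ell,\ell}_{N-m,m}(\tau):=C^{N}_{m,\ell}(q):=q^{s(m,\ell,N)}\,\mathcal{C}^{N}_{m,\ell}(q),\qquad s(m,\ell,N):=-\frac18+\frac{(\ell+1)^2}{4(N+2)}-\frac{m^2}{4N},$$ $$\mathcal{C}^{N}_{m,\ell}(q):=\frac{1}{J_1^3}\sum_{j\in\mathbb{Z}}\;\sum_{i\ge 0}(-1)^i q^{\frac12 i(i+m)+j((N+2)j+\ell+1)}\Bigl\{q^{\frac12 i(2(N+2)j+\ell+1)}-q^{-\frac12 i(2(N+2)j+\ell+1)}\Bigr\},$$ where the sum over $i$ is taken first. Then, for every $\tau$ with $\operatorname{Im}\tau>0$, in the iterated sums defining $c^{20}_{20}=C^{2}_{0,0}$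 and $c^{20}_{02}=C^{2}_{2,0}$ both the inner sums over $i$ and the outer sum over $j$ converge absolutely, and $$c^{20}_{20}(\tau)-c^{20}_{02}(\tau)=\eta(\tau)^{-2}\,\eta(\tau/2).$$ -/

import Mathlib

/-- The power `q ^ a`, for `q = exp (2 π i τ)` and a real exponent `a`, with the branch
fixed by `τ`: `q ^ a = exp (2 π i a τ)`. -/
noncomputable def qpow (τ : UpperHalfPlane) (a : ℝ) : ℂ :=
  Complex.exp (2 * (Real.pi : ℂ) * Complex.I * (a : ℂ) * (τ : ℂ))

/-- `J₁ = ∏_{n ≥ 1} (1 - q ^ n)`. -/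
noncomputable def eulerJ (τ : UpperHalfPlane) : ℂ :=
  ∏' n : ℕ, (1 - qpow τ ((n : ℝ) + 1))

/-- The `(j, i)`-term
`(-1)^i q^{i(i+m)/2 + j((N+2)j+ℓ+1)} { q^{i(2(N+2)j+ℓ+1)/2} - q^{-i(2(N+2)j+ℓ+1)/2} }`
of the double sum that defines the string functions. -/
noncomputable def stringTerm (m ℓ N : ℤ) (τ : UpperHalfPlane) (j : ℤ) (i : ℕ) : ℂ :=
  (-1) ^ i
    * qpow τ ((1 / 2) * (i : ℝ) * ((i : ℝ) + (m : ℝ))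
        + (j : ℝ) * (((N : ℝ) + 2) * (j : ℝ) + (ℓ : ℝ) + 1))
    * (qpow τ ((1 / 2) * (i : ℝ) * (2 * ((N : ℝ) + 2) * (j : ℝ) + (ℓ : ℝ) + 1))
        - qpow τ (-((1 / 2) * (i : ℝ) * (2 * ((N : ℝ) + 2) * (j : ℝ) + (ℓ : ℝ) + 1))))

/-- The normalised string function `𝒞_{m,ℓ}^N = J₁⁻³ ∑_{j ∈ ℤ} ∑_{i ∈ ℕ} (…)`. The double sum
is not absolutely convergent; it is the iterated sum, with the sum over `i` inside. -/
noncomputable def stringCalC (m ℓ N : ℤ) (τ : UpperHalfPlane) : ℂ :=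
  1 / eulerJ τ ^ 3 * ∑' j : ℤ, ∑' i : ℕ, stringTerm m ℓ N τ j i

/-- The exponent `s(m, ℓ, N) = -1/8 + (ℓ+1)²/(4(N+2)) - m²/(4N)`. -/
noncomputable def stringExponent (m ℓ N : ℤ) : ℝ :=
  -(1 / 8) + ((ℓ : ℝ) + 1) ^ 2 / (4 * ((N : ℝ) + 2)) - (m : ℝ) ^ 2 / (4 * (N : ℝ))

/-- The level-`N` string function `C_{m,ℓ}^N = q^{s(m,ℓ,N)} 𝒞_{m,ℓ}^N` of `A₁⁽¹⁾`
(for `N ≥ 1`, `0 ≤ ℓ ≤ N`, `m ≡ ℓ mod 2`), written `c_{N-m,m}^{N-ℓ,ℓ}` by Kac and Peterson. -/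
noncomputable def stringC (m ℓ N : ℤ) (τ : UpperHalfPlane) : ℂ :=
  qpow τ (stringExponent m ℓ N) * stringCalC m ℓ N τ

/-- The string function in the notation `c_{b₀ b₁}^{a₀ a₁}`, where `a₀ + a₁ = b₀ + b₁ = N` is the
level, `a₁ = ℓ` and `b₁ = m`. The argument `_b₀` is determined by the other three. -/
noncomputable def stringFunction (a₀ a₁ _b₀ b₁ : ℤ) (τ : UpperHalfPlane) : ℂ :=
  stringC b₁ a₁ (a₀ + a₁) τ

open Filter Topology

/-! Write h(r) = (-1)^r q^{r(r+1)/4} (`halfTheta`) and a(r) = ∑_{k≥0} (-1)^k q^{k(k+1)/2+kr}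
(`appellCoeff`). Summing over i turns both string functions into sums of products h·a. The
symmetries a(-1-r) = 1 - a(r), h(-1-r) = -h(r) and the shift q^r a(r) = 1 - a(r-1) reduce the first
to indices 0 mod 4 and the second to indices 2 mod 4. The reflection r ↦ -1-r supplies the classes 3
and 1, so the difference is J₁⁻³ q^{-1/16} ∑_r h(r)a(r) (`tsum_sub_tsum_eq_thetaQuot`).

This sum is c(0), where c(n) = ∑_m h(m)a(m+n). Up to a constant, the c(n) are the Laurent
coefficients of a theta function for q^{1/2} divided by one for q. The functional equation of the
quotient gives c(n) = (-1)^n q^{n²/2} c(0) (`thetaQuot_eq`). Both theta functions vanish at z = 1,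
so l'Hôpital's rule gives ∑ c(n) = J₁(τ/2)³, by Jacobi's identity for the cube;
`hasSum_mul_thetaQuot_sub` is this argument in terms of coefficients. Gauss's formula ∑ (-1)^n
q^{n²/2} = J₁(τ/2)²/J₁(τ) then yields c(0) = J₁(τ/2)J₁(τ) (`thetaQuot_zero`).

The identities of Jacobi and Gauss are limits of a finite triple product. -/

/-! ### Powers of q and Gaussian series. -/

lemma qpow_add (τ : UpperHalfPlane) (a b : ℝ) : qpow τ (a + b) = qpow τ a * qpow τ b := by
  simp only [qpow, ← Complex.exp_add]
  congr 1
  push_cast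
  ring

@[simp] lemma qpow_zero (τ : UpperHalfPlane) : qpow τ 0 = 1 := by simp [qpow]

lemma qpow_ne_zero (τ : UpperHalfPlane) (a : ℝ) : qpow τ a ≠ 0 := Complex.exp_ne_zero _

lemma norm_qpow (τ : UpperHalfPlane) (a : ℝ) :
    ‖qpow τ a‖ = Real.exp (-(2 * Real.pi * τ.im * a)) := by
  simp only [qpow, Complex.norm_exp]
  congr 1
  simp
  ring

lemma norm_qpow_le_of_le (τ : UpperHalfPlane) {a b : ℝ} (h : a ≤ b) :
    ‖qpow τ b‖ ≤ ‖qpow τ a‖ := by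
  rw [norm_qpow, norm_qpow, Real.exp_le_exp]
  have : 0 < 2 * Real.pi * τ.im := by have := τ.im_pos; positivity
  nlinarith

lemma norm_qpow_lt_one (τ : UpperHalfPlane) {a : ℝ} (h : 0 < a) : ‖qpow τ a‖ < 1 := by
  rw [norm_qpow, Real.exp_lt_one_iff]
  have : 0 < 2 * Real.pi * τ.im := by have := τ.im_pos; positivity
  nlinarith

lemma qpow_nat_mul (τ : UpperHalfPlane) (n : ℕ) (a : ℝ) : qpow τ (n * a) = qpow τ a ^ n := by
  simp only [qpow, ← Complex.exp_nat_mul]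
  congr 1
  push_cast
  ring

lemma qpow_natCast (τ : UpperHalfPlane) (n : ℕ) : qpow τ n = qpow τ 1 ^ n := by
  rw [← qpow_nat_mul, mul_one]

/-- Gaussian series in `q`, with polynomial weights, converge absolutely. -/
lemma summable_pow_mul_norm_qpow (τ : UpperHalfPlane) {α : ℝ} (hα : 0 < α) (β γ : ℝ) (d : ℕ) :
    Summable fun k : ℤ => |(k : ℝ)| ^ d * ‖qpow τ (α * (k : ℝ) ^ 2 + β * k + γ)‖ := by
  have hy := τ.im_pos
  have h := (summable_pow_mul_jacobiTheta₂_term_bound (τ.im * |β|)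
    (T := 2 * τ.im * α) (by positivity) d).mul_right ‖qpow τ γ‖
  refine Summable.of_nonneg_of_le (fun k => by positivity) (fun k => ?_) h
  rw [qpow_add, norm_mul, ← mul_assoc, norm_qpow τ (_ + _)]
  refine mul_le_mul_of_nonneg_right ?_ (norm_nonneg _)
  push_cast
  refine mul_le_mul_of_nonneg_left ?_ (by positivity)
  rw [Real.exp_le_exp]
  have h1 : -(β * k) ≤ |β| * |(k : ℝ)| := by
    rw [← abs_mul]; exact neg_le_abs _
  have : 0 < 2 * Real.pi * τ.im := by positivity
  nlinarith [mul_le_mul_of_nonneg_left h1 this.le]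

lemma norm_neg_one_zpow (k : ℤ) : ‖(-1 : ℂ) ^ k‖ = 1 := by simp

/-! ### Finite q-products, their reciprocals and their limits. -/

/-- The partial product `∏_{1 ≤ i ≤ n} (1 - q ^ i)`. -/
noncomputable def qPoch (τ : UpperHalfPlane) (n : ℕ) : ℂ :=
  ∏ i ∈ Finset.range n, (1 - qpow τ ((i : ℝ) + 1))

/-- The reciprocal of `∏_{1 ≤ i ≤ n} (1 - q ^ i)`, extended by zero to negative `n`. -/
noncomputable def qPochInv (τ : UpperHalfPlane) (n : ℤ) : ℂ :=
  if n < 0 then 0 else (qPoch τ n.toNat)⁻¹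

lemma one_sub_qpow_ne_zero (τ : UpperHalfPlane) {a : ℝ} (h : 0 < a) : 1 - qpow τ a ≠ 0 := by
  intro h0
  have := norm_qpow_lt_one τ h
  rw [← sub_eq_zero.mp h0] at this
  simp at this

lemma qPoch_succ (τ : UpperHalfPlane) (n : ℕ) :
    qPoch τ (n + 1) = qPoch τ n * (1 - qpow τ ((n : ℝ) + 1)) := Finset.prod_range_succ _ _

lemma qPoch_ne_zero (τ : UpperHalfPlane) (n : ℕ) : qPoch τ n ≠ 0 :=
  Finset.prod_ne_zero_iff.mpr fun i _ => one_sub_qpow_ne_zero τ (by positivity)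

/-- The extension by zero is consistent with the recursion: at m = -1 the factor 1 - q^0 vanishes.
Hence the Gaussian binomials below need no boundary cases. -/
lemma qPochInv_eq (τ : UpperHalfPlane) (m : ℤ) :
    qPochInv τ m = (1 - qpow τ ((m : ℝ) + 1)) * qPochInv τ (m + 1) := by
  rcases lt_trichotomy m (-1) with h | h | h
  · simp [qPochInv, show m < 0 by lia, show m + 1 < 0 by lia]
  · subst h
    simp [qPochInv]
  · lift m to ℕ using by lia
    have h1 : ((m : ℤ) + 1).toNat = m + 1 := by lia
    have := one_sub_qpow_ne_zero τ (a := (m : ℝ) + 1) (by positivity)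
    have := qPoch_ne_zero τ m
    simp only [qPochInv, show ¬ ((m : ℤ) < 0) by lia, show ¬ ((m : ℤ) + 1 < 0) by lia, if_false, h1,
      qPoch_succ, Int.toNat_natCast, Int.cast_natCast]
    field_simp

lemma multipliable_eulerJ (τ : UpperHalfPlane) :
    Multipliable fun n : ℕ => 1 - qpow τ ((n : ℝ) + 1) := by
  have h := ModularForm.multipliable_one_sub_pow (norm_qpow_lt_one τ one_pos)
  refine h.congr fun n => ?_
  rw [← qpow_natCast]
  push_cast
  rfl

lemma tendsto_qPoch (τ : UpperHalfPlane) : Tendsto (qPoch τ) atTop (𝓝 (eulerJ τ)) :=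
  (multipliable_eulerJ τ).hasProd.tendsto_prod_nat

lemma eulerJ_ne_zero (τ : UpperHalfPlane) : eulerJ τ ≠ 0 := by
  have h := tprod_one_add_ne_zero_of_summable (f := fun n : ℕ => -qpow τ ((n : ℝ) + 1))
    (fun i => by
      rw [← sub_eq_add_neg]; exact one_sub_qpow_ne_zero τ (by positivity))
    (by
      have h := (summable_nat_add_iff 1).mpr
        (summable_geometric_of_lt_one (norm_nonneg _) (norm_qpow_lt_one τ one_pos))
      refine h.congr fun n => ?_
      rw [norm_neg, ← norm_pow, ← qpow_natCast]
      push_cast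
      rfl)
  simpa only [eulerJ, sub_eq_add_neg] using h

lemma tendsto_qPochInv (τ : UpperHalfPlane) :
    Tendsto (qPochInv τ) atTop (𝓝 (eulerJ τ)⁻¹) := by
  have h : Tendsto (fun n : ℕ => qPochInv τ n) atTop (𝓝 (eulerJ τ)⁻¹) := by
    refine ((tendsto_qPoch τ).inv₀ (eulerJ_ne_zero τ)).congr fun n => ?_
    rw [qPochInv, if_neg (by lia), Int.toNat_natCast]
  have h2 := h.comp (tendsto_atTop.mpr fun n => by
    filter_upwards [eventually_ge_atTop (n : ℤ)] with m hm
    lia : Tendsto Int.toNat atTop atTop)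
  refine h2.congr' ?_
  filter_upwards [eventually_ge_atTop 0] with m hm
  simp [hm]

lemma exists_norm_qPoch_le (τ : UpperHalfPlane) : ∃ C : ℝ, 0 ≤ C ∧ ∀ n, ‖qPoch τ n‖ ≤ C := by
  obtain ⟨C, hC⟩ := (tendsto_qPoch τ).norm.bddAbove_range
  exact ⟨C, (norm_nonneg _).trans (hC ⟨0, rfl⟩), fun n => hC ⟨n, rfl⟩⟩

lemma exists_norm_qPochInv_le (τ : UpperHalfPlane) :
    ∃ C : ℝ, 0 ≤ C ∧ ∀ n, ‖qPochInv τ n‖ ≤ C := by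
  obtain ⟨C, hC⟩ := ((tendsto_qPoch τ).inv₀ (eulerJ_ne_zero τ)).norm.bddAbove_range
  have h0 : 0 ≤ C := (norm_nonneg _).trans (hC ⟨0, rfl⟩)
  refine ⟨C, h0, fun n => ?_⟩
  unfold qPochInv
  split_ifs
  · simpa using h0
  · exact hC ⟨n.toNat, rfl⟩

/-! ### The finite triple product and the identities of Jacobi and Gauss. -/

/-- The Gaussian binomial coefficient `[2n, n + k]`. -/
noncomputable def qCentral (τ : UpperHalfPlane) (n : ℕ) (k : ℤ) : ℂ :=
  qPoch τ (2 * n) * qPochInv τ (n + k) * qPochInv τ (n - k)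

/-- The general term of the theta series at the point `q ^ b`. -/
noncomputable def tripleTerm (τ : UpperHalfPlane) (b : ℝ) (k : ℤ) : ℂ :=
  (-1) ^ k * qpow τ ((k : ℝ) * (k + 1) / 2 + k * b)

lemma qCentral_zero (τ : UpperHalfPlane) (k : ℤ) :
    qCentral τ 0 k = if k = 0 then 1 else 0 := by
  rcases lt_trichotomy k 0 with h | h | h
  · simp [qCentral, qPochInv, h, h.ne]
  · simp [h, qCentral, qPochInv, qPoch]
  · simp [qCentral, qPochInv, h, h.ne']

/-- With x = q^b, this is the effect on coefficients of multiplying by (1 - x q^{n+1})(1 - x⁻¹ q^n)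
= 1 + q^{2n+1} - x q^{n+1} - x⁻¹ q^n, the new factors of the product at stage n + 1. -/
lemma tripleTerm_mul_qCentral_succ (τ : UpperHalfPlane) (b : ℝ) (n : ℕ) (k : ℤ) :
    tripleTerm τ b k * qCentral τ (n + 1) k
      = (1 + qpow τ (2 * n + 1)) * (tripleTerm τ b k * qCentral τ n k)
        - qpow τ (b + n + 1) * (tripleTerm τ b (k - 1) * qCentral τ n (k - 1))
        - qpow τ (-b + n) * (tripleTerm τ b (k + 1) * qCentral τ n (k + 1)) := by
  have e1 : qpow τ (b + n + 1) * tripleTerm τ b (k - 1)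
      = -(qpow τ 1 * qpow τ (n - k) * tripleTerm τ b k) := by
    have : qpow τ (b + n + 1) * qpow τ (((k - 1 : ℤ) : ℝ) * ((k - 1 : ℤ) + 1) / 2 + (k - 1 : ℤ) * b)
        = qpow τ 1 * qpow τ (n - k) * qpow τ ((k : ℝ) * (k + 1) / 2 + k * b) := by
      simp only [← qpow_add]
      congr 1
      push_cast
      ring
    rw [tripleTerm, tripleTerm, mul_left_comm, this, zpow_sub_one₀ (by norm_num)]
    ring
  have e2 : qpow τ (-b + n) * tripleTerm τ b (k + 1)
      = -(qpow τ 1 * qpow τ (n + k) * tripleTerm τ b k) := by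
    have : qpow τ (-b + n) * qpow τ (((k + 1 : ℤ) : ℝ) * ((k + 1 : ℤ) + 1) / 2 + (k + 1 : ℤ) * b)
        = qpow τ 1 * qpow τ (n + k) * qpow τ ((k : ℝ) * (k + 1) / 2 + k * b) := by
      simp only [← qpow_add]
      congr 1
      push_cast
      ring
    rw [tripleTerm, tripleTerm, mul_left_comm, this, zpow_add_one₀ (by norm_num)]
    ring
  rw [← mul_assoc (qpow τ (b + n + 1)), ← mul_assoc (qpow τ (-b + n)), e1, e2]
  have e3 : qpow τ (2 * n + 1) = qpow τ 1 * qpow τ (n + k) * qpow τ (n - k) := by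
    simp only [← qpow_add]; congr 1; ring
  have e4 : qPoch τ (2 * (n + 1)) = qPoch τ (2 * n)
      * (1 - qpow τ 1 * qpow τ (n + k) * qpow τ (n - k))
      * (1 - qpow τ 1 ^ 2 * qpow τ (n + k) * qpow τ (n - k)) := by
    rw [show 2 * (n + 1) = 2 * n + 1 + 1 by ring, qPoch_succ, qPoch_succ]
    simp only [pow_two, ← qpow_add]
    congr 3
    · congr 1
      push_cast
      ring
    · push_cast
      ring
  -- All reciprocals are expressed through those at n + k + 1 and n - k + 1; a polynomial identity
  -- in q, q^{n+k}, q^{n-k} remains.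
  have R1 := qPochInv_eq τ (n + k)
  have R2 := qPochInv_eq τ (n + k - 1)
  have R3 := qPochInv_eq τ (n - k)
  have R4 := qPochInv_eq τ (n - k - 1)
  have c1 : qpow τ (((n + k : ℤ) : ℝ) + 1) = qpow τ 1 * qpow τ (n + k) := by
    rw [← qpow_add]; congr 1; push_cast; ring
  have c2 : qpow τ (((n + k - 1 : ℤ) : ℝ) + 1) = qpow τ (n + k) := by
    congr 1; push_cast; ring
  have c3 : qpow τ (((n - k : ℤ) : ℝ) + 1) = qpow τ 1 * qpow τ (n - k) := by
    rw [← qpow_add]; congr 1; push_cast; ring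
  have c4 : qpow τ (((n - k - 1 : ℤ) : ℝ) + 1) = qpow τ (n - k) := by
    congr 1; push_cast; ring
  rw [c1] at R1
  rw [c2, sub_add_cancel, R1] at R2
  rw [c3] at R3
  rw [c4, sub_add_cancel, R3] at R4
  simp only [qCentral]
  rw [show ((n + 1 : ℕ) : ℤ) + k = n + k + 1 by push_cast; ring,
    show ((n + 1 : ℕ) : ℤ) - k = n - k + 1 by push_cast; ring,
    show (n : ℤ) + (k - 1) = n + k - 1 by ring, show (n : ℤ) - (k - 1) = n - k + 1 by ring,
    show (n : ℤ) - (k + 1) = n - k - 1 by ring, show (n : ℤ) + (k + 1) = n + k + 1 by ring,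
    R2, R4, R1, R3, e3, e4]
  ring

lemma HasSum.of_eq {ι : Type*} {f : ι → ℂ} {s t : ℂ} (h : HasSum f s) (e : s = t) : HasSum f t :=
  e ▸ h

lemma HasSum.int_shift {f : ℤ → ℂ} {s : ℂ} (h : HasSum f s) (c : ℤ) :
    HasSum (fun k => f (k + c)) s :=
  (Equiv.addRight c).hasSum_iff.mpr h

/-- The finite form of the Jacobi triple product identity. -/
lemma hasSum_tripleTerm_mul_qCentral (τ : UpperHalfPlane) (b : ℝ) (n : ℕ) :
    HasSum (fun k => tripleTerm τ b k * qCentral τ n k)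
      (∏ i ∈ Finset.range n, (1 - qpow τ (b + i + 1)) * (1 - qpow τ (-b + i))) := by
  induction n with
  | zero =>
    simp only [qCentral_zero, Finset.range_zero, Finset.prod_empty]
    convert hasSum_ite_eq (0 : ℤ) (1 : ℂ) using 2 with k
    split_ifs with h <;> simp [h, tripleTerm]
  | succ n ih =>
    simp only [tripleTerm_mul_qCentral_succ]
    refine (((ih.mul_left (1 + qpow τ (2 * n + 1))).sub
      ((ih.int_shift (-1)).mul_left (qpow τ (b + n + 1)))).sub
      ((ih.int_shift 1).mul_left (qpow τ (-b + n)))).of_eq ?_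
    rw [Finset.prod_range_succ,
      show qpow τ (2 * n + 1) = qpow τ (b + n + 1) * qpow τ (-b + n) by
        rw [← qpow_add]; congr 1; ring]
    ring

/-- This is x d/dx of the finite triple product at x = q^b = 1: only the derivative of the vanishing
factor 1 - x⁻¹ survives. The recursion in n transports the sum s and the weighted sum d together. -/
lemma hasSum_mul_tripleTerm_mul_qCentral (τ : UpperHalfPlane) (n : ℕ) :
    HasSum (fun k : ℤ => (k : ℂ) * (tripleTerm τ 0 k * qCentral τ (n + 1) k))
      (qPoch τ (n + 1) * qPoch τ n) := by
  have step : ∀ (n : ℕ) {s d : ℂ}, HasSum (fun k => tripleTerm τ 0 k * qCentral τ n k) s →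
      HasSum (fun k : ℤ => (k : ℂ) * (tripleTerm τ 0 k * qCentral τ n k)) d →
      HasSum (fun k : ℤ => (k : ℂ) * (tripleTerm τ 0 k * qCentral τ (n + 1) k))
        ((1 + qpow τ (2 * n + 1)) * d - qpow τ (n + 1) * (d + s) - qpow τ n * (d - s)) := by
    intro n s d hs hd
    have h1 := (hd.add hs).int_shift (-1)
    have h2 := (hd.sub hs).int_shift 1
    refine (((hd.mul_left (1 + qpow τ (2 * n + 1))).sub
      (h1.mul_left (qpow τ (n + 1)))).sub (h2.mul_left (qpow τ n))).congr_fun ?_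
    intro k
    rw [tripleTerm_mul_qCentral_succ]
    simp only [zero_add, neg_zero, ← sub_eq_add_neg]
    push_cast
    ring
  induction n with
  | zero =>
    have hs := hasSum_tripleTerm_mul_qCentral τ 0 0
    have hd : HasSum (fun k : ℤ => (k : ℂ) * (tripleTerm τ 0 k * qCentral τ 0 k)) 0 := by
      convert hasSum_zero using 2 with k
      rw [qCentral_zero]
      split_ifs with h <;> simp [h]
    refine (step 0 hs hd).of_eq ?_
    simp [qPoch]
    ring
  | succ n ih =>
    have hs : HasSum (fun k => tripleTerm τ 0 k * qCentral τ (n + 1) k) 0 := by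
      refine (hasSum_tripleTerm_mul_qCentral τ 0 (n + 1)).of_eq ?_
      -- The factor i = 0 contains 1 - q^0.
      rw [Finset.prod_eq_zero (Finset.mem_range.mpr n.succ_pos)]
      simp
    refine (step (n + 1) hs ih).of_eq ?_
    rw [show qpow τ (2 * ((n + 1 : ℕ) : ℝ) + 1) = qpow τ ((n + 1 : ℕ) + 1) * qpow τ (n + 1 : ℕ) by
        rw [← qpow_add]; congr 1; ring, qPoch_succ τ (n + 1), qPoch_succ τ n]
    push_cast
    ring

lemma summable_pow_mul_norm_tripleTerm (τ : UpperHalfPlane) (b : ℝ) (d : ℕ) :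
    Summable fun k : ℤ => ‖(k : ℂ) ^ d * tripleTerm τ b k‖ := by
  refine (summable_pow_mul_norm_qpow τ (α := 1 / 2) (by norm_num) (1 / 2 + b) 0 d).congr fun k => ?_
  rw [tripleTerm, norm_mul, norm_mul, norm_neg_one_zpow, one_mul, norm_pow, Complex.norm_intCast]
  congr 3
  ring

/-- Passage to the limit in the finite form of the triple product identity. -/
lemma tendsto_tsum_mul_qCentral (τ : UpperHalfPlane) {w : ℤ → ℂ} (hw : Summable fun k => ‖w k‖) :
    Tendsto (fun n => ∑' k, w k * qCentral τ n k) atTop (𝓝 ((∑' k, w k) / eulerJ τ)) := by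
  obtain ⟨C, hC0, hC⟩ := exists_norm_qPoch_le τ
  obtain ⟨D, hD0, hD⟩ := exists_norm_qPochInv_le τ
  rw [← tsum_div_const]
  refine tendsto_tsum_of_dominated_convergence (hw.mul_right (C * D * D)) (fun k => ?_)
    (Eventually.of_forall fun n k => ?_)
  · rw [div_eq_mul_inv]
    refine Tendsto.const_mul _ ?_
    have h1 : Tendsto (fun n : ℕ => qPoch τ (2 * n)) atTop (𝓝 (eulerJ τ)) :=
      (tendsto_qPoch τ).comp (tendsto_id.const_mul_atTop' two_pos)
    have h2 : Tendsto (fun n : ℕ => qPochInv τ (n + k)) atTop (𝓝 (eulerJ τ)⁻¹) :=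
      (tendsto_qPochInv τ).comp (tendsto_atTop_add_const_right _ k tendsto_natCast_atTop_atTop)
    have h3 : Tendsto (fun n : ℕ => qPochInv τ (n - k)) atTop (𝓝 (eulerJ τ)⁻¹) :=
      (tendsto_qPochInv τ).comp (tendsto_atTop_add_const_right _ (-k) tendsto_natCast_atTop_atTop)
    have := (h1.mul h2).mul h3
    rwa [mul_inv_cancel₀ (eulerJ_ne_zero τ), one_mul] at this
  · rw [norm_mul, qCentral, norm_mul, norm_mul]
    gcongr
    exacts [hC _, hD _, hD _]

/-- Jacobi's identity for the cube of the Euler product. -/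
lemma tsum_mul_tripleTerm (τ : UpperHalfPlane) :
    ∑' k : ℤ, (k : ℂ) * tripleTerm τ 0 k = eulerJ τ ^ 3 := by
  have h1 := (tendsto_tsum_mul_qCentral τ (w := fun k => (k : ℂ) * tripleTerm τ 0 k)
    (by simpa using summable_pow_mul_norm_tripleTerm τ 0 1)).comp (tendsto_add_atTop_nat 1)
  have h2 : Tendsto (fun n => qPoch τ (n + 1) * qPoch τ n) atTop (𝓝 (eulerJ τ * eulerJ τ)) :=
    ((tendsto_qPoch τ).comp (tendsto_add_atTop_nat 1)).mul (tendsto_qPoch τ)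
  have h3 := tendsto_nhds_unique (h1.congr fun n => by
    rw [← (hasSum_mul_tripleTerm_mul_qCentral τ n).tsum_eq]
    simp [mul_assoc]) h2
  rw [div_eq_iff (eulerJ_ne_zero τ)] at h3
  rw [h3]
  ring

/-- The point `τ / 2` of the upper half plane. -/
noncomputable def halfPoint (τ : UpperHalfPlane) : UpperHalfPlane :=
  ⟨(τ : ℂ) / 2, by simpa using τ.im_pos⟩

lemma qpow_halfPoint (τ : UpperHalfPlane) (a : ℝ) : qpow (halfPoint τ) a = qpow τ (a / 2) := by
  simp only [qpow, halfPoint]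
  congr 1
  push_cast
  ring

lemma qPoch_halfPoint (τ : UpperHalfPlane) (n : ℕ) :
    qPoch (halfPoint τ) (2 * n)
      = (∏ i ∈ Finset.range n, (1 - qpow τ ((i : ℝ) + 1 / 2))) * qPoch τ n := by
  induction n with
  | zero => simp [qPoch]
  | succ n ih =>
    rw [show 2 * (n + 1) = 2 * n + 1 + 1 by ring, qPoch_succ, qPoch_succ, ih, qPoch_succ,
      Finset.prod_range_succ, qpow_halfPoint, qpow_halfPoint,
      show (((2 * n : ℕ) : ℝ) + 1) / 2 = n + 1 / 2 by push_cast; ring,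
      show (((2 * n + 1 : ℕ) : ℝ) + 1) / 2 = n + 1 by push_cast; ring]
    ring

/-- Gauss's product formula for `∑ (-1)^k q^{k² / 2}`. -/
lemma tsum_tripleTerm_neg_half (τ : UpperHalfPlane) :
    (∑' k : ℤ, tripleTerm τ (-1 / 2) k) * eulerJ τ = eulerJ (halfPoint τ) ^ 2 := by
  have h1 := tendsto_tsum_mul_qCentral τ (w := tripleTerm τ (-1 / 2))
    (by simpa using summable_pow_mul_norm_tripleTerm τ (-1 / 2) 0)
  have h2 : Tendsto (fun n => (qPoch (halfPoint τ) (2 * n) / qPoch τ n) ^ 2) atTop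
      (𝓝 ((eulerJ (halfPoint τ) / eulerJ τ) ^ 2)) :=
    (((tendsto_qPoch (halfPoint τ)).comp (tendsto_id.const_mul_atTop' two_pos)).div
      (tendsto_qPoch τ) (eulerJ_ne_zero τ)).pow 2
  have h3 := tendsto_nhds_unique (h1.congr fun n => by
    rw [(hasSum_tripleTerm_mul_qCentral τ (-1 / 2) n).tsum_eq, qPoch_halfPoint,
      mul_div_cancel_right₀ _ (qPoch_ne_zero τ n), ← Finset.prod_pow]
    -- At b = -1/2 both factors equal 1 - q^{i+1/2}, whence the square.
    refine Finset.prod_congr rfl fun i _ => ?_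
    rw [pow_two]
    congr 3 <;> ring) h2
  have := eulerJ_ne_zero τ
  rw [div_pow, div_eq_div_iff this (pow_ne_zero 2 this)] at h3
  refine mul_right_cancel₀ this (Eq.trans ?_ h3)
  ring

/-! ### Coefficients of the reciprocal theta function. -/

/-- The Laurent coefficients `∑_{k ≥ 0} (-1)^k q^{k (k + 1) / 2 + k r}` of the reciprocal of a
theta function. -/
noncomputable def appellCoeff (τ : UpperHalfPlane) (r : ℤ) : ℂ := ∑' k : ℕ, tripleTerm τ r k

/-- The theta coefficients `(-1)^r q^{r (r + 1) / 4}`. -/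
noncomputable def halfTheta (τ : UpperHalfPlane) (r : ℤ) : ℂ := tripleTerm (halfPoint τ) 0 r

lemma halfTheta_eq (τ : UpperHalfPlane) (r : ℤ) :
    halfTheta τ r = (-1) ^ r * qpow τ ((r : ℝ) * (r + 1) / 4) := by
  rw [halfTheta, tripleTerm, qpow_halfPoint]
  congr 2
  ring

lemma tripleTerm_zero (τ : UpperHalfPlane) (b : ℝ) : tripleTerm τ b 0 = 1 := by simp [tripleTerm]

lemma summable_tripleTerm (τ : UpperHalfPlane) (b : ℝ) : Summable (tripleTerm τ b) := by
  simpa using (summable_pow_mul_norm_tripleTerm τ b 0).of_norm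

lemma summable_tripleTerm_nat (τ : UpperHalfPlane) (b : ℝ) :
    Summable fun k : ℕ => tripleTerm τ b k :=
  (summable_tripleTerm τ b).comp_injective Nat.cast_injective

lemma neg_one_zpow_sub_two_mul (a b : ℤ) : (-1 : ℂ) ^ (a - 2 * b) = (-1) ^ a := by
  rw [zpow_sub₀ (by norm_num), zpow_mul]
  simp

lemma neg_one_zpow_neg (a : ℤ) : (-1 : ℂ) ^ (-a) = (-1) ^ a := by
  rw [← neg_one_zpow_sub_two_mul a a]
  congr 1
  ring

/-- The reflection preserves the exponent and changes the parity of k, so the full theta series at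
an integral point cancels in pairs. -/
lemma tripleTerm_reflect (τ : UpperHalfPlane) (r k : ℤ) :
    tripleTerm τ r (-1 - 2 * r - k) = -tripleTerm τ r k := by
  rw [tripleTerm, tripleTerm, show -1 - 2 * r - k = -(k + 1) - 2 * r by ring,
    neg_one_zpow_sub_two_mul, neg_one_zpow_neg, zpow_add_one₀ (by norm_num), mul_neg_one, neg_mul]
  congr 3
  push_cast
  ring

lemma tsum_tripleTerm_int (τ : UpperHalfPlane) (r : ℤ) : ∑' k, tripleTerm τ r k = 0 := by
  have h := (Equiv.subLeft (-1 - 2 * r)).tsum_eq (tripleTerm τ r)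
  simp only [Equiv.subLeft_apply, tripleTerm_reflect, tsum_neg] at h
  exact self_eq_neg.mp h.symm

lemma halfTheta_reflect (τ : UpperHalfPlane) (r : ℤ) : halfTheta τ (-1 - r) = -halfTheta τ r := by
  simpa [halfTheta] using tripleTerm_reflect (halfPoint τ) 0 r

lemma summable_norm_halfTheta (τ : UpperHalfPlane) : Summable fun r => ‖halfTheta τ r‖ := by
  simpa [halfTheta] using summable_pow_mul_norm_tripleTerm (halfPoint τ) 0 0

lemma summable_norm_mul_halfTheta (τ : UpperHalfPlane) :
    Summable fun r : ℤ => ‖(r : ℂ) * halfTheta τ r‖ := by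
  simpa only [pow_one, halfTheta] using summable_pow_mul_norm_tripleTerm (halfPoint τ) 0 1

lemma tsum_halfTheta (τ : UpperHalfPlane) : ∑' r, halfTheta τ r = 0 := by
  simpa [halfTheta] using tsum_tripleTerm_int (halfPoint τ) 0

/-- Replacing k by -k makes the left side the sum over k ≤ 0 of the series for r. The two halves
overlap at k = 0, whose term is 1, and the full series vanishes. -/
lemma appellCoeff_neg_one_sub (τ : UpperHalfPlane) (r : ℤ) :
    appellCoeff τ (-1 - r) = 1 - appellCoeff τ r := by
  have e : ∀ k : ℕ, tripleTerm τ ((-1 - r : ℤ) : ℝ) k = tripleTerm τ r (-k) := fun k => by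
    rw [tripleTerm, tripleTerm, neg_one_zpow_neg]
    congr 2
    push_cast
    ring
  have hs : Summable fun k : ℕ => tripleTerm τ r (-k) :=
    (summable_tripleTerm τ r).comp_injective (neg_injective.comp Nat.cast_injective)
  have hz := (HasSum.of_nat_of_neg_add_one (summable_tripleTerm_nat τ r).hasSum
    ((summable_tripleTerm τ r).comp_injective (i := fun k : ℕ => -((k : ℤ) + 1))
      (fun a b h => by simpa using h)).hasSum).tsum_eq
  rw [tsum_tripleTerm_int] at hz
  rw [appellCoeff, tsum_congr e, hs.tsum_eq_zero_add]
  simp only [Nat.cast_zero, neg_zero, tripleTerm_zero, Nat.cast_add, Nat.cast_one]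
  simp only [Function.comp_def] at hz
  rw [appellCoeff]
  linear_combination -hz

lemma qpow_mul_appellCoeff (τ : UpperHalfPlane) (r : ℤ) :
    qpow τ r * appellCoeff τ r = 1 - appellCoeff τ (r - 1) := by
  rw [appellCoeff, appellCoeff, (summable_tripleTerm_nat τ ((r - 1 : ℤ) : ℝ)).tsum_eq_zero_add,
    ← tsum_mul_left, Nat.cast_zero, tripleTerm_zero, sub_add_cancel_left, ← tsum_neg]
  refine tsum_congr fun k => ?_
  rw [tripleTerm, tripleTerm, Nat.cast_add, Nat.cast_one, zpow_add_one₀ (by norm_num), mul_left_comm,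
    ← qpow_add, mul_neg_one, neg_mul, neg_neg]
  congr 2
  push_cast
  ring

lemma exists_norm_appellCoeff_le_of_nonneg (τ : UpperHalfPlane) :
    ∃ C : ℝ, 0 ≤ C ∧ ∀ r : ℤ, 0 ≤ r → ‖appellCoeff τ r‖ ≤ C := by
  refine ⟨∑' k : ℕ, ‖tripleTerm τ 0 k‖, tsum_nonneg fun _ => norm_nonneg _, fun r hr => ?_⟩
  have h0 := (summable_tripleTerm_nat τ 0).norm
  refine tsum_of_norm_bounded h0.hasSum fun k => ?_
  simp only [tripleTerm, norm_mul, norm_neg_one_zpow, one_mul]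
  refine norm_qpow_le_of_le τ ?_
  have : (0 : ℝ) ≤ r := by exact_mod_cast hr
  have : (0 : ℝ) ≤ ((k : ℤ) : ℝ) * r := by positivity
  linarith

/-- The difference of `appellCoeff` and the indicator function of the nonnegative integers. -/
noncomputable def appellTail (τ : UpperHalfPlane) (r : ℤ) : ℂ :=
  appellCoeff τ r - if 0 ≤ r then 1 else 0

/-- The shift relation extracts a factor q^{r+1} for r ≥ 0 and, with the reflection, q^{-r} for r <
0; the remaining coefficient has nonnegative index and is bounded. -/
lemma exists_norm_appellTail_le (τ : UpperHalfPlane) :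
    ∃ C : ℝ, 0 ≤ C ∧ ∀ r : ℤ, ‖appellTail τ r‖ ≤ C * ‖qpow τ 1‖ ^ r.natAbs := by
  obtain ⟨C, hC0, hC⟩ := exists_norm_appellCoeff_le_of_nonneg τ
  refine ⟨C, hC0, fun r => ?_⟩
  rw [← norm_pow, ← qpow_natCast, mul_comm]
  rcases le_or_gt 0 r with h | h
  · have e : appellTail τ r = -(qpow τ ((r + 1 : ℤ) : ℝ) * appellCoeff τ (r + 1)) := by
      rw [qpow_mul_appellCoeff, appellTail, if_pos h, add_sub_cancel_right]
      ring
    rw [e, norm_neg, norm_mul]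
    gcongr
    · refine norm_qpow_le_of_le τ ?_
      rw [Nat.cast_natAbs, abs_of_nonneg h]
      push_cast
      linarith
    · exact hC _ (by lia)
  · have e : appellTail τ r = qpow τ ((-r : ℤ) : ℝ) * appellCoeff τ (-r) := by
      rw [qpow_mul_appellCoeff, appellTail, if_neg (by lia), ← appellCoeff_neg_one_sub]
      ring_nf
    rw [e, norm_mul]
    gcongr
    · refine norm_qpow_le_of_le τ ?_
      rw [Nat.cast_natAbs, abs_of_neg h]
    · exact hC _ (by lia)

lemma exists_norm_appellCoeff_le (τ : UpperHalfPlane) :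
    ∃ C : ℝ, 0 ≤ C ∧ ∀ r : ℤ, ‖appellCoeff τ r‖ ≤ C := by
  obtain ⟨C, hC0, hC⟩ := exists_norm_appellTail_le τ
  refine ⟨C + 1, by positivity, fun r => ?_⟩
  have e : appellCoeff τ r = appellTail τ r + if 0 ≤ r then 1 else 0 := by simp [appellTail]
  rw [e]
  refine (norm_add_le _ _).trans (add_le_add ((hC r).trans ?_) ?_)
  · exact mul_le_of_le_one_right hC0
      (pow_le_one₀ (norm_nonneg _) (norm_qpow_lt_one τ one_pos).le)
  · split_ifs <;> simp

lemma summable_pow_mul_appellTail (τ : UpperHalfPlane) (d : ℕ) :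
    Summable fun r : ℤ => (r : ℂ) ^ d * appellTail τ r := by
  obtain ⟨C, hC0, hC⟩ := exists_norm_appellTail_le τ
  have h : Summable fun r : ℤ => (r.natAbs : ℝ) ^ d * ‖qpow τ 1‖ ^ r.natAbs := by
    have := summable_pow_mul_geometric_of_norm_lt_one d (r := ‖qpow τ 1‖)
      (by simpa using norm_qpow_lt_one τ one_pos)
    exact summable_int_iff_summable_nat_and_neg.mpr ⟨by simpa using this, by simpa using this⟩
  refine Summable.of_norm_bounded (h.mul_left C) fun r => ?_
  rw [norm_mul, norm_pow, Complex.norm_intCast, mul_left_comm, Nat.cast_natAbs, Int.cast_abs]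
  gcongr
  exact hC r

lemma appellCoeff_sub_eq (τ : UpperHalfPlane) (r : ℤ) :
    appellCoeff τ r - appellCoeff τ (r - 1)
      = appellTail τ r - appellTail τ (r - 1) + if r = 0 then 1 else 0 := by
  simp only [appellTail]
  split_ifs <;> first | lia | ring

/-- The coefficients climb from 0 at -∞ to 1 at +∞; this jump reflects the simple pole of the
reciprocal theta function at z = 1. -/
lemma hasSum_appellCoeff_sub (τ : UpperHalfPlane) :
    HasSum (fun r => appellCoeff τ r - appellCoeff τ (r - 1)) 1 := by
  simp only [appellCoeff_sub_eq]
  have h : Summable (appellTail τ) := by simpa using summable_pow_mul_appellTail τ 0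
  exact ((h.hasSum.sub (h.hasSum.int_shift (-1))).add (hasSum_ite_eq (0 : ℤ) (1 : ℂ))).of_eq
    (by ring)

lemma summable_mul_appellCoeff_sub (τ : UpperHalfPlane) :
    Summable fun r : ℤ => (r : ℂ) * (appellCoeff τ r - appellCoeff τ (r - 1)) := by
  have h0 : Summable (appellTail τ) := by simpa using summable_pow_mul_appellTail τ 0
  have h1 : Summable fun r : ℤ => (r : ℂ) * appellTail τ r := by
    simpa using summable_pow_mul_appellTail τ 1
  have h2 := ((h1.add h0).hasSum.int_shift (-1)).summable
  refine (h1.sub h2).congr fun r => ?_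
  rw [appellCoeff_sub_eq]
  simp only [← sub_eq_add_neg]
  split_ifs with h
  · simp [h]
  · push_cast
    ring

lemma summable_halfTheta_mul_appellCoeff (τ : UpperHalfPlane) (n : ℤ) :
    Summable fun m => halfTheta τ m * appellCoeff τ (m + n) := by
  obtain ⟨C, hC0, hC⟩ := exists_norm_appellCoeff_le τ
  refine Summable.of_norm_bounded ((summable_norm_halfTheta τ).mul_right C) fun m => ?_
  rw [norm_mul]
  gcongr
  exact hC _

/-! ### The quotient of two theta functions. -/

/-- The Laurent coefficients of the quotient of two theta functions. -/
noncomputable def thetaQuot (τ : UpperHalfPlane) (n : ℤ) : ℂ :=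
  ∑' m, halfTheta τ m * appellCoeff τ (m + n)

lemma qpow_neg_mul_halfTheta (τ : UpperHalfPlane) (m : ℤ) :
    qpow τ (-m) * halfTheta τ m = qpow τ (-1 / 2) * halfTheta τ (m - 2) := by
  rw [halfTheta_eq, halfTheta_eq, mul_left_comm, mul_left_comm (qpow τ (-1 / 2)), ← qpow_add,
    ← qpow_add, show m - 2 = m - 2 * 1 by ring, neg_one_zpow_sub_two_mul]
  congr 2
  push_cast
  ring

/-- Splitting q^n = q^{-m} q^{m+n} shifts h by two and a by one; the inhomogeneous term drops out
because ∑ h = 0. -/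
lemma thetaQuot_add_one (τ : UpperHalfPlane) (n : ℤ) :
    thetaQuot τ (n + 1) = -(qpow τ (n + 1 / 2) * thetaQuot τ n) := by
  have h1 : qpow τ n * thetaQuot τ n = -(qpow τ (-1 / 2) * thetaQuot τ (n + 1)) := by
    have e : ∀ m : ℤ, qpow τ n * (halfTheta τ m * appellCoeff τ (m + n))
        = qpow τ (-1 / 2) * (halfTheta τ (m + -2)
          - halfTheta τ (m + -2) * appellCoeff τ (m + -2 + (n + 1))) := fun m => by
      have hq : qpow τ n = qpow τ (-m) * qpow τ ((m + n : ℤ) : ℝ) := by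
        rw [← qpow_add]; congr 1; push_cast; ring
      have := qpow_mul_appellCoeff τ (m + n)
      rw [hq, mul_mul_mul_comm, this, qpow_neg_mul_halfTheta, ← sub_eq_add_neg,
        show m - 2 + (n + 1) = m + n - 1 by ring]
      ring
    rw [thetaQuot, ← tsum_mul_left, tsum_congr e, tsum_mul_left]
    have h := ((summable_norm_halfTheta τ).of_norm.hasSum.sub
      (summable_halfTheta_mul_appellCoeff τ (n + 1)).hasSum).int_shift (-2)
    rw [h.tsum_eq, tsum_halfTheta, thetaQuot]
    ring
  rw [show ((n : ℝ) + 1 / 2) = 1 / 2 + n by ring, qpow_add, mul_assoc, h1, mul_neg, neg_neg,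
    ← mul_assoc, ← qpow_add]
  norm_num

lemma thetaQuot_eq (τ : UpperHalfPlane) (n : ℤ) :
    thetaQuot τ n = tripleTerm τ (-1 / 2) n * thetaQuot τ 0 := by
  have key : ∀ n : ℤ, tripleTerm τ (-1 / 2) (n + 1)
      = -(qpow τ (n + 1 / 2) * tripleTerm τ (-1 / 2) n) := fun n => by
    rw [tripleTerm, tripleTerm, mul_left_comm, ← qpow_add, zpow_add_one₀ (by norm_num),
      mul_neg_one, neg_mul]
    congr 3
    push_cast
    ring
  induction n with
  | zero => rw [tripleTerm_zero, one_mul]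
  | succ n ih => rw [thetaQuot_add_one, ih, key]; ring
  | pred n ih =>
    have h1 := thetaQuot_add_one τ (-n - 1)
    have h2 := key (-n - 1)
    rw [sub_add_cancel] at h1 h2
    rw [h1, h2] at ih
    refine mul_left_cancel₀ (qpow_ne_zero τ (((-n - 1 : ℤ) : ℝ) + 1 / 2)) ?_
    linear_combination -ih

/-- Reindexing of pairs of integers by their difference. -/
def diffEquiv : ℤ × ℤ ≃ ℤ × ℤ where
  toFun p := (p.2, p.2 + p.1)
  invFun p := (p.2 - p.1, p.1)
  left_inv p := by simp
  right_inv p := by simp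

/-- With r = m + n and d(r) = a(r) - a(r-1), the weight n = r - m splits the double sum into (∑ h)(∑
r d) - (∑ m h)(∑ d) = 0 - J₁(τ/2)³. Differencing a is what makes it absolutely convergent. -/
lemma hasSum_mul_thetaQuot_sub (τ : UpperHalfPlane) :
    HasSum (fun n : ℤ => (n : ℂ) * (thetaQuot τ n - thetaQuot τ (n - 1)))
      (-eulerJ (halfPoint τ) ^ 3) := by
  set d : ℤ → ℂ := fun r => appellCoeff τ r - appellCoeff τ (r - 1) with hd
  have d0 : HasSum d 1 := hasSum_appellCoeff_sub τ
  have d1 : Summable fun r : ℤ => (r : ℂ) * d r := summable_mul_appellCoeff_sub τ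
  have h0 := summable_norm_halfTheta τ
  have h1 := summable_norm_mul_halfTheta τ
  have s1 := (summable_mul_of_summable_norm h0 d1.norm).hasSum
  have s2 := (summable_mul_of_summable_norm h1 d0.summable.norm).hasSum
  rw [← tsum_mul_tsum_of_summable_norm h0 d1.norm, tsum_halfTheta, zero_mul] at s1
  rw [← tsum_mul_tsum_of_summable_norm h1 d0.summable.norm, d0.tsum_eq, mul_one,
    show ∑' r : ℤ, (r : ℂ) * halfTheta τ r = _ from tsum_mul_tripleTerm (halfPoint τ)] at s2
  have s3 := diffEquiv.hasSum_iff.mpr ((s1.sub s2).of_eq (zero_sub _))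
  have e : ∀ n : ℤ, HasSum (fun m => halfTheta τ m * d (m + n))
      (thetaQuot τ n - thetaQuot τ (n - 1)) := fun n => by
    refine ((summable_halfTheta_mul_appellCoeff τ n).hasSum.sub
      (summable_halfTheta_mul_appellCoeff τ (n - 1)).hasSum).congr_fun fun m => ?_
    rw [hd, ← mul_sub, ← add_sub_assoc]
  refine s3.prod_fiberwise fun n => ((e n).mul_left (n : ℂ)).congr_fun fun m => ?_
  simp only [diffEquiv, Function.comp_apply, Equiv.coe_fn_mk]
  push_cast
  ring

/-- The constant coefficient of the theta quotient. -/
lemma thetaQuot_zero (τ : UpperHalfPlane) :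
    thetaQuot τ 0 = eulerJ (halfPoint τ) * eulerJ τ := by
  have h0 : Summable (thetaQuot τ) := by
    refine ((summable_tripleTerm τ (-1 / 2)).mul_right (thetaQuot τ 0)).congr fun n => ?_
    rw [← thetaQuot_eq]
  have h1 : Summable fun n : ℤ => (n : ℂ) * thetaQuot τ n := by
    have := (summable_pow_mul_norm_tripleTerm τ (-1 / 2) 1).of_norm.mul_right (thetaQuot τ 0)
    refine this.congr fun n => ?_
    rw [thetaQuot_eq τ n, pow_one, mul_assoc]
  -- Summation by parts: ∑ n (c(n) - c(n-1)) = -∑ c(n).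
  have h2 := h1.hasSum.sub ((h1.add h0).hasSum.int_shift (-1))
  have h3 := (h2.congr_fun (g := fun n : ℤ => (n : ℂ) * (thetaQuot τ n - thetaQuot τ (n - 1)))
    fun n => by
      simp only [← sub_eq_add_neg]
      push_cast
      ring).unique (hasSum_mul_thetaQuot_sub τ)
  rw [h1.tsum_add h0, sub_add_cancel_left, neg_inj, tsum_congr (thetaQuot_eq τ), tsum_mul_right]
    at h3
  have h4 := tsum_tripleTerm_neg_half τ
  refine mul_left_cancel₀ (pow_ne_zero 2 (eulerJ_ne_zero (halfPoint τ))) ?_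
  linear_combination eulerJ τ * h3 - thetaQuot τ 0 * h4

/-! ### The level-two string functions. -/

lemma stringTerm_level_two_zero (τ : UpperHalfPlane) (j : ℤ) (i : ℕ) :
    stringTerm 0 0 2 τ j i = halfTheta τ (4 * j)
      * (tripleTerm τ ((4 * j : ℤ) : ℝ) i - tripleTerm τ ((-1 - 4 * j : ℤ) : ℝ) i) := by
  have hs : (-1 : ℂ) ^ (4 * j) = 1 := Even.neg_one_zpow ⟨2 * j, by ring⟩
  rw [stringTerm, halfTheta_eq, tripleTerm, tripleTerm, hs, one_mul, zpow_natCast, ← mul_sub,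
    mul_assoc, mul_left_comm (qpow _ _) ((-1 : ℂ) ^ i), mul_sub (qpow _ _), mul_sub (qpow _ _)]
  simp only [← qpow_add]
  congr 3 <;> · push_cast; ring

lemma stringTerm_level_two_two (τ : UpperHalfPlane) (j : ℤ) (i : ℕ) :
    stringTerm 2 0 2 τ j i = halfTheta τ (4 * j)
      * (tripleTerm τ ((4 * j + 1 : ℤ) : ℝ) i - tripleTerm τ ((-(4 * j) : ℤ) : ℝ) i) := by
  have hs : (-1 : ℂ) ^ (4 * j) = 1 := Even.neg_one_zpow ⟨2 * j, by ring⟩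
  rw [stringTerm, halfTheta_eq, tripleTerm, tripleTerm, hs, one_mul, zpow_natCast, ← mul_sub,
    mul_assoc, mul_left_comm (qpow _ _) ((-1 : ℂ) ^ i), mul_sub (qpow _ _), mul_sub (qpow _ _)]
  simp only [← qpow_add]
  congr 3 <;> · push_cast; ring

lemma hasSum_stringTerm_level_two_zero (τ : UpperHalfPlane) (j : ℤ) :
    HasSum (fun i => stringTerm 0 0 2 τ j i)
      (halfTheta τ (4 * j) * (2 * appellCoeff τ (4 * j) - 1)) := by
  simp only [stringTerm_level_two_zero]
  refine (((summable_tripleTerm_nat τ _).hasSum.sub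
    (summable_tripleTerm_nat τ _).hasSum).mul_left _).of_eq ?_
  have := appellCoeff_neg_one_sub τ (4 * j)
  simp only [appellCoeff] at this ⊢
  rw [this]
  ring

lemma hasSum_stringTerm_level_two_two (τ : UpperHalfPlane) (j : ℤ) :
    HasSum (fun i => stringTerm 2 0 2 τ j i)
      (halfTheta τ (4 * j) * (appellCoeff τ (4 * j + 1) - appellCoeff τ (-(4 * j)))) := by
  simp only [stringTerm_level_two_two]
  exact ((summable_tripleTerm_nat τ _).hasSum.sub (summable_tripleTerm_nat τ _).hasSum).mul_left _

/-- The factor q^{-1/2} is the ratio of the two string prefactors. It moves the indices to the class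
2 mod 4, split between 4j - 2 and 4j + 2; shifting j in one part aligns them. -/
lemma qpow_neg_half_mul_halfTheta (τ : UpperHalfPlane) (j : ℤ) :
    qpow τ (-1 / 2)
        * (halfTheta τ (4 * j) * (appellCoeff τ (4 * j + 1) - appellCoeff τ (-(4 * j))))
      = halfTheta τ (4 * (j - 1) + 2) * (1 - appellCoeff τ (4 * (j - 1) + 2))
        - halfTheta τ (4 * j + 2) * appellCoeff τ (4 * j + 2) := by
  have h1 := qpow_mul_appellCoeff τ (4 * j + 2)
  have h2 := qpow_mul_appellCoeff τ (1 - 4 * j)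
  have h3 := appellCoeff_neg_one_sub τ (4 * j - 2)
  have h4 := qpow_neg_mul_halfTheta τ (4 * j + 2)
  have h5 := qpow_neg_mul_halfTheta τ (4 * j)
  have e1 : qpow τ (-((4 * j + 2 : ℤ) : ℝ)) * qpow τ ((4 * j + 2 : ℤ) : ℝ) = 1 := by
    rw [← qpow_add, neg_add_cancel, qpow_zero]
  have e2 : qpow τ (-1 / 2) * qpow τ ((1 - 4 * j : ℤ) : ℝ) * halfTheta τ (4 * j)
      = halfTheta τ (4 * j - 2) := by
    have : qpow τ (-1 / 2) * qpow τ ((1 - 4 * j : ℤ) : ℝ)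
        = qpow τ (1 / 2) * qpow τ (-((4 * j : ℤ) : ℝ)) := by
      simp only [← qpow_add]; congr 1; push_cast; ring
    rw [this, mul_assoc, h5, ← mul_assoc, ← qpow_add]
    norm_num
  rw [show 4 * j + 2 - 1 = 4 * j + 1 by ring] at h1
  rw [show 1 - 4 * j - 1 = -(4 * j) by ring] at h2
  rw [show -1 - (4 * j - 2) = 1 - 4 * j by ring] at h3
  rw [show 4 * j + 2 - 2 = 4 * j by ring] at h4
  rw [show 4 * (j - 1) + 2 = 4 * j - 2 by ring, ← h3, ← e2]
  linear_combination qpow τ (-1 / 2) * halfTheta τ (4 * j) * h1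
    - qpow τ (-1 / 2) * halfTheta τ (4 * j) * h2
    + appellCoeff τ (4 * j + 2) * qpow τ ((4 * j + 2 : ℤ) : ℝ) * h4
    - appellCoeff τ (4 * j + 2) * halfTheta τ (4 * j + 2) * e1

lemma HasSum.int_mod_four {g : ℤ → ℂ} {s s₀ s₁ s₂ s₃ : ℂ} (h : HasSum g s)
    (h₀ : HasSum (fun j => g (4 * j)) s₀) (h₁ : HasSum (fun j => g (4 * j + 1)) s₁)
    (h₂ : HasSum (fun j => g (4 * j + 2)) s₂) (h₃ : HasSum (fun j => g (4 * j + 3)) s₃) :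
    s = s₀ + s₁ + s₂ + s₃ := by
  have h' := ((Int.divModEquiv 4).symm.hasSum_iff.mpr h).prod_fiberwise
    fun j => hasSum_fintype _
  refine h'.unique ((((h₀.add h₁).add h₂).add h₃).congr_fun fun j => ?_)
  simp [Fin.sum_univ_four, Int.divModEquiv, mul_comm]

lemma summable_halfTheta_mul_appellCoeff_comp (τ : UpperHalfPlane) {e : ℤ → ℤ}
    (he : Function.Injective e) : Summable fun j => halfTheta τ (e j) * appellCoeff τ (e j) := by
  have h := summable_halfTheta_mul_appellCoeff τ 0
  simp only [add_zero] at h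
  exact h.comp_injective he

lemma summable_halfTheta_comp (τ : UpperHalfPlane) {e : ℤ → ℤ}
    (he : Function.Injective e) : Summable fun j => halfTheta τ (e j) :=
  (summable_norm_halfTheta τ).of_norm.comp_injective he

lemma summable_tsum_stringTerm_zero (τ : UpperHalfPlane) :
    Summable fun j : ℤ => halfTheta τ (4 * j) * (2 * appellCoeff τ (4 * j) - 1) := by
  have he : Function.Injective fun j : ℤ => 4 * j := fun a b h => by simpa using h
  refine (((summable_halfTheta_mul_appellCoeff_comp τ he).mul_left 2).sub
    (summable_halfTheta_comp τ he)).congr fun j => ?_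
  ring

lemma hasSum_tsum_stringTerm_two (τ : UpperHalfPlane) :
    HasSum (fun j : ℤ => halfTheta τ (4 * j)
        * (appellCoeff τ (4 * j + 1) - appellCoeff τ (-(4 * j))))
      (qpow τ (1 / 2) * ∑' j : ℤ, halfTheta τ (4 * j + 2) * (1 - 2 * appellCoeff τ (4 * j + 2))) := by
  have he : Function.Injective fun j : ℤ => 4 * j + 2 := fun a b h => by simpa using h
  have h1 := summable_halfTheta_mul_appellCoeff_comp τ he
  have h0 := summable_halfTheta_comp τ he
  have h2 := ((h0.sub h1).hasSum.int_shift (-1)).sub h1.hasSum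
  rw [← (h0.sub h1).tsum_sub h1] at h2
  have hq : qpow τ (1 / 2) * qpow τ (-1 / 2) = 1 := by
    rw [← qpow_add]; norm_num
  refine ((h2.mul_left (qpow τ (1 / 2))).congr_fun fun j => ?_).of_eq ?_
  · have := qpow_neg_half_mul_halfTheta τ j
    simp only [← sub_eq_add_neg]
    rw [← mul_one_sub, ← this, ← mul_assoc, hq, one_mul]
  · congr 1
    refine tsum_congr fun j => ?_
    ring

lemma tsum_sub_tsum_eq_thetaQuot (τ : UpperHalfPlane) :
    ∑' j : ℤ, halfTheta τ (4 * j) * (2 * appellCoeff τ (4 * j) - 1)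
      - ∑' j : ℤ, halfTheta τ (4 * j + 2) * (1 - 2 * appellCoeff τ (4 * j + 2))
      = thetaQuot τ 0 := by
  have i0 : Function.Injective fun j : ℤ => 4 * j := fun a b h => by simpa using h
  have i2 : Function.Injective fun j : ℤ => 4 * j + 2 := fun a b h => by simpa using h
  have a0 := summable_halfTheta_mul_appellCoeff_comp τ i0
  have a2 := summable_halfTheta_mul_appellCoeff_comp τ i2
  have b0 := summable_halfTheta_comp τ i0
  have b2 := summable_halfTheta_comp τ i2
  have odd : ∀ r : ℤ, halfTheta τ (-1 - r) * appellCoeff τ (-1 - r)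
      = halfTheta τ r * appellCoeff τ r - halfTheta τ r := fun r => by
    rw [halfTheta_reflect, appellCoeff_neg_one_sub]
    ring
  have h := summable_halfTheta_mul_appellCoeff τ 0
  simp only [add_zero] at h
  -- Since 4j + 1 = -1 - (4(-1-j) + 2) and 4j + 3 = -1 - 4(-1-j), the odd classes come from the even
  -- ones by reflection.
  have c1 := (Equiv.subLeft (-1 : ℤ)).hasSum_iff.mpr (a2.sub b2).hasSum
  have c3 := (Equiv.subLeft (-1 : ℤ)).hasSum_iff.mpr (a0.sub b0).hasSum
  have key := h.hasSum.int_mod_four a0.hasSum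
    (c1.congr_fun fun j => by
      simp only [Function.comp_apply, Equiv.subLeft_apply]
      rw [← odd]
      ring_nf) a2.hasSum
    (c3.congr_fun fun j => by
      simp only [Function.comp_apply, Equiv.subLeft_apply]
      rw [← odd]
      ring_nf)
  simp only [thetaQuot, add_zero]
  have t0 : ∑' j : ℤ, halfTheta τ (4 * j) * (2 * appellCoeff τ (4 * j) - 1) = _ :=
    (tsum_congr fun j => by ring).trans (a0.tsum_add (a0.sub b0))
  have t2 : ∑' j : ℤ, -(halfTheta τ (4 * j + 2) * (1 - 2 * appellCoeff τ (4 * j + 2))) = _ :=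
    (tsum_congr fun j => by ring).trans (a2.tsum_add (a2.sub b2))
  rw [key, sub_eq_add_neg, ← tsum_neg, t0, t2]
  ring

/-! ### The eta function and the conclusion. -/

lemma eta_eq (τ : UpperHalfPlane) :
    ModularForm.eta (τ : ℂ) = qpow τ (1 / 24) * eulerJ τ := by
  rw [ModularForm.eta, eulerJ]
  congr 1
  · simp only [Function.Periodic.qParam, qpow]
    congr 1
    push_cast
    ring
  · refine tprod_congr fun n => ?_
    rw [ModularForm.eta_q_eq_cexp, qpow]
    push_cast
    ring_nf

theorem mainTheorem6 (τ : UpperHalfPlane) :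
    (∀ m : ℤ, m = 0 ∨ m = 2 →
      (∀ j : ℤ, Summable fun i : ℕ => stringTerm m 0 2 τ j i) ∧
      Summable fun j : ℤ => ∑' i : ℕ, stringTerm m 0 2 τ j i) ∧
    stringFunction 2 0 2 0 τ - stringFunction 2 0 0 2 τ
      = (ModularForm.eta (τ : ℂ) ^ 2)⁻¹ * ModularForm.eta ((τ : ℂ) / 2) := by
  have h0 := hasSum_stringTerm_level_two_zero τ
  have h2 := hasSum_stringTerm_level_two_two τ
  refine ⟨fun m hm => ?_, ?_⟩
  · rcases hm with rfl | rfl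
    · refine ⟨fun j => (h0 j).summable, ?_⟩
      simp only [fun j => (h0 j).tsum_eq]
      exact summable_tsum_stringTerm_zero τ
    · refine ⟨fun j => (h2 j).summable, ?_⟩
      simp only [fun j => (h2 j).tsum_eq]
      exact (hasSum_tsum_stringTerm_two τ).summable
  · have hη : ModularForm.eta ((τ : ℂ) / 2) = qpow τ (1 / 48) * eulerJ (halfPoint τ) := by
      have := eta_eq (halfPoint τ)
      rw [qpow_halfPoint, show (1 / 24 / 2 : ℝ) = 1 / 48 by norm_num] at this
      exact this
    have e0 : stringExponent 0 0 2 = -1 / 16 := by norm_num [stringExponent]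
    have e2 : stringExponent 2 0 2 = -1 / 16 + -1 / 2 := by norm_num [stringExponent]
    have key := (tsum_sub_tsum_eq_thetaQuot τ).trans (thetaQuot_zero τ)
    have hq : qpow τ (-1 / 2) * qpow τ (1 / 2) = 1 := by
      rw [← qpow_add]; norm_num
    -- The exponents of q match: -1/16 + 2/24 = 1/48.
    have hq' : qpow τ (-1 / 16) * qpow τ (1 / 24) ^ 2 = qpow τ (1 / 48) := by
      rw [← qpow_nat_mul, ← qpow_add]
      norm_num
    simp only [stringFunction, stringC, stringCalC, add_zero, e0, e2, fun j => (h0 j).tsum_eq,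
      fun j => (h2 j).tsum_eq, (hasSum_tsum_stringTerm_two τ).tsum_eq]
    have hJ := eulerJ_ne_zero τ
    have hE := qpow_ne_zero τ (1 / 24)
    rw [hη, eta_eq, ← hq', qpow_add]
    generalize qpow τ (-1 / 16) = u at *
    generalize qpow τ (-1 / 2) = v at *
    generalize qpow τ (1 / 2) = w at *
    generalize qpow τ (1 / 24) = t at *
    field_simp
    linear_combination u * key
      - u * (∑' j : ℤ, halfTheta τ (4 * j + 2) * (1 - 2 * appellCoeff τ (4 * j + 2))) * hq
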